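/- Let $\Bbbk$ be a field, let $S=\Bbbk[x_1,\dots,x_n]$ with the standard grading, and let $2\le c\le n$. Let $$I_{n,c}=\bigcap_{1\le i_1<\dots<i_c\le n}(x_{i_1},\dots,x_{i_c})\subset S,$$ and let $I_{n,c}^{(2)}$ be its second symbolic power, that is, $I^{(2)}=\bigcap_P (I^2S_P\cap S)$ for $I=I_{n,c}$, where $P$ runs over the minimal primes of $I$. For a homogeneous ideal $I$ and integers $i\ge 0$ and $j$, let $\beta_{i,j}(I)=\dim_\Bbbk \operatorname{Tor}^S_i(I,\Bbbk)_j$ be the graded Betti numbers of $I$ (computed from an arbitrary graded free resolution of $I$, which exists). Put $\binom{a}{b}=0$ for $b<0$. If $c<n$, then for all $i\ge 0$ and all $j\in\mathbb Z$ $$\beta_{i,i+j}\bigl(I_{n,c}^{(2)}\bigr)=\begin{cases}\binom{n}{c-2-i}\binom{n-c+1+i}{i}, & j=n-c+2,\\[2pt] \binom{n}{c-1}\binom{c-1}{i}, & j=2(n-c+1),\\[2pt] 0, & \text{otherwise.}\end{cases}$$ If $c=n$, the two degrees $n-c+2$ and $2(n-c+1)$ are both equal to $2$ and the contributions add up: for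 all $i\ge 0$ and all $j\in\mathbb Z$ $$\beta_{i,i+j}\bigl(I_{n,n}^{(2)}\bigr)=\begin{cases}\binom{n}{n-2-i}(i+1)+ n\binom{n-1}{i}, & j=2,\\[2pt] 0, & \text{otherwise.}\end{cases}$$ -/

import Mathlib

open MvPolynomial

universe u

namespace StarConfiguration

noncomputable section

/-- The ideal `I_{n,c}` of `k[x_1, …, x_n]`: the intersection of the ideals
`(x_{i_1}, …, x_{i_c})` over all `c`-element subsets `{i_1 < ⋯ < i_c}` of the variables. -/
def starIdeal (k : Type u) [Field k] (n c : ℕ) : Ideal (MvPolynomial (Fin n) k) :=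
  ⨅ (A : Finset (Fin n)) (_ : A.card = c), Ideal.span (X '' (A : Set (Fin n)))

/-- The `m`-th symbolic power `I^{(m)} = ⋂_P (I^m R_P ∩ R)`, where `P` runs over the minimal
primes of `I`.  (For a radical ideal these are also the associated primes of `R / I`.) -/
def symbolicPower {R : Type u} [CommRing R] (I : Ideal R) (m : ℕ) : Ideal R :=
  ⨅ P : I.minimalPrimes,
    haveI : (P : Ideal R).IsPrime := P.2.1.1
    ((I ^ m).map (algebraMap R (Localization.AtPrime (P : Ideal R)))).comap
      (algebraMap R (Localization.AtPrime (P : Ideal R)))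

/-- A graded free resolution `⋯ → F_2 → F_1 → F_0 → I → 0` of an ideal `I` of the standard graded
polynomial ring `S = k[x_1, …, x_n]`.  The module `F_i = ⨁_b S(-deg b)` is free on a set `ι i` of
homogeneous basis elements, and all maps are `S`-linear and homogeneous of degree `0`.  The
augmentation is given as a map to `S` with image `I`. -/
structure GradedFreeResolution {k : Type u} [Field k] {n : ℕ}
    (I : Ideal (MvPolynomial (Fin n) k)) where
  /-- the basis of `F_i` -/
  ι : ℕ → Type u
  /-- the degrees of the basis elements of `F_i` -/
  deg : ∀ i, ι i → ℤ
  /-- the differential `F_{i+1} → F_i` -/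
  d : ∀ i, (ι (i + 1) →₀ MvPolynomial (Fin n) k) →ₗ[MvPolynomial (Fin n) k]
    (ι i →₀ MvPolynomial (Fin n) k)
  /-- the augmentation `F_0 → I ⊆ S` -/
  ε : (ι 0 →₀ MvPolynomial (Fin n) k) →ₗ[MvPolynomial (Fin n) k] MvPolynomial (Fin n) k
  /-- every monomial of the matrix entry at `(b, b')` has degree `deg b - deg b'` -/
  d_homogeneous : ∀ i b b' (m : Fin n →₀ ℕ),
    coeff m (d i (Finsupp.single b 1) b') ≠ 0 → (m.degree : ℤ) + deg i b' = deg (i + 1) b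
  ε_homogeneous : ∀ b (m : Fin n →₀ ℕ),
    coeff m (ε (Finsupp.single b 1)) ≠ 0 → (m.degree : ℤ) = deg 0 b
  range_ε : LinearMap.range ε = I
  exact_zero : LinearMap.ker ε = LinearMap.range (d 0)
  exact_succ : ∀ i, LinearMap.ker (d i) = LinearMap.range (d (i + 1))

namespace GradedFreeResolution

variable {k : Type u} [Field k] {n : ℕ} {I : Ideal (MvPolynomial (Fin n) k)}
  (F : GradedFreeResolution I)

/-- The differential of the complex `F ⊗_S k` of `k`-vector spaces, where
`k = S / (x_1, …, x_n)`.  The space `F_i ⊗_S k` has the `k`-basis `ι i`, and the matrix of the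
differential is that of `F` reduced modulo `(x_1, …, x_n)`, that is, it consists of the constant
coefficients of the entries. -/
def tensorD (i : ℕ) : (F.ι (i + 1) →₀ k) →ₗ[k] (F.ι i →₀ k) :=
  Finsupp.linearCombination k fun b =>
    (F.d i (Finsupp.single b 1)).mapRange constantCoeff (map_zero _)

/-- The homogeneous part `(F_i ⊗_S k)_j`, spanned by the basis elements of degree `j`. -/
def piece (i : ℕ) (j : ℤ) : Submodule k (F.ι i →₀ k) :=
  Finsupp.supported k k {b | F.deg i b = j}

/-- The cycles of `F ⊗_S k` in homological degree `i`. -/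
def cycles : ∀ i, Submodule k (F.ι i →₀ k)
  | 0 => ⊤
  | i + 1 => LinearMap.ker (F.tensorD i)

/-- The boundaries of `F ⊗_S k` in homological degree `i`. -/
def boundaries (i : ℕ) : Submodule k (F.ι i →₀ k) :=
  LinearMap.range (F.tensorD i)

/-- The vector space `Tor_i^S(I, k)_j`, computed from the graded free resolution `F` of `I`: the
part of degree `j` of the homology `H_i(F ⊗_S k)`.  Homology (cycles modulo boundaries) is taken
inside the quotient of `F_i ⊗_S k` by the boundaries, and its part of degree `j` consists of the
classes of the cycles of degree `j`. -/
def tor (i : ℕ) (j : ℤ) : Submodule k ((F.ι i →₀ k) ⧸ F.boundaries i) :=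
  (F.cycles i ⊓ F.piece i j).map (F.boundaries i).mkQ

/-- The graded Betti number `β_{i,j}(I) = dim_k Tor_i^S(I, k)_j`, a cardinal number. -/
def betti (i : ℕ) (j : ℤ) : Cardinal.{u} :=
  Module.rank k (F.tor i j)

end GradedFreeResolution

end

end StarConfiguration

/-! The symbolic square is a monomial ideal: the contraction of $I^2$ from the localization at $(x_i
: i\in A)$ is spanned by the monomials of degree at least $2$ in the variables of $A$
(`comap_map_starIdeal_pow`). A pigeonhole argument (`exists_le_iff`) shows that the monomials
meeting this for all $c$-subsets $A$ are generated by the squarefree monomials of degree $n-c+2$ and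
the squares of those of degree $n-c+1$.

These generators have linear quotients: added one at a time in non-decreasing degree $e$, each has a
colon ideal generated by some $t$ variables. The mapping cone of the Koszul-type resolution of the
colon ideal then contributes $\binom{t}{i}$ basis elements of degree $i+e$ in homological degree
$i$, and it stays minimal for degree reasons (`tensorD_cone`, `HasMinimalResolution.add`). Here
$t=p-d$ for $x_p x_A$ with $A$ a $d$-set among $x_0,\dots,x_{p-1}$, and $t=c-1$ for every square.
Summing gives the table.

An arbitrary resolution has the same Betti numbers because two resolutions are homotopy equivalent
(`betti_eq`), and for a minimal one they count basis elements (`betti_eq_card`). -/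

namespace StarConfiguration

noncomputable section

/-! ### Graded maps of free modules and their reduction modulo the variables. -/

section GradedMaps

variable {k : Type*} [Field k] {n : ℕ} {ι κ μ : Type*}

/-- A linear map of free modules with homogeneous bases of degrees `a` and `b` is graded if all
entries of its matrix are homogeneous of the expected degree. -/
def IsGradedMap (a : ι → ℤ) (b : κ → ℤ)
    (f : (ι →₀ MvPolynomial (Fin n) k) →ₗ[MvPolynomial (Fin n) k]
      (κ →₀ MvPolynomial (Fin n) k)) : Prop :=
  ∀ i j (m : Fin n →₀ ℕ), coeff m (f (Finsupp.single i 1) j) ≠ 0 → (m.degree : ℤ) + b j = a i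

/-- The homogeneous component of integral degree `z` of a polynomial. -/
def intComponent (z : ℤ) : MvPolynomial (Fin n) k →ₗ[k] MvPolynomial (Fin n) k :=
  if 0 ≤ z then homogeneousComponent z.toNat else 0

lemma coeff_intComponent (z : ℤ) (m : Fin n →₀ ℕ) (p : MvPolynomial (Fin n) k) :
    coeff m (intComponent z p) = if (m.degree : ℤ) = z then coeff m p else 0 := by
  unfold intComponent
  split_ifs with h1 h2 h2
  · rw [coeff_homogeneousComponent, if_pos (by omega)]
  · rw [coeff_homogeneousComponent, if_neg (by omega)]
  · omega
  · simp

/-- The component of degree `D` of an element of a free module with basis of degrees `a`. -/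
def freeComponent (a : ι → ℤ) (D : ℤ) :
    (ι →₀ MvPolynomial (Fin n) k) →ₗ[k] (ι →₀ MvPolynomial (Fin n) k) :=
  Finsupp.lsum k fun l => Finsupp.lsingle l ∘ₗ intComponent (D - a l)

lemma freeComponent_single (a : ι → ℤ) (D : ℤ) (l : ι) (p : MvPolynomial (Fin n) k) :
    freeComponent a D (Finsupp.single l p) = Finsupp.single l (intComponent (D - a l) p) := by
  simp [freeComponent]

lemma coeff_freeComponent (a : ι → ℤ) (D : ℤ) (v : ι →₀ MvPolynomial (Fin n) k) (j : ι)
    (m : Fin n →₀ ℕ) :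
    coeff m (freeComponent a D v j) = if (m.degree : ℤ) + a j = D then coeff m (v j) else 0 := by
  induction v using Finsupp.induction_linear with
  | zero => simp
  | add f g hf hg =>
    rw [map_add, Finsupp.add_apply, coeff_add, hf, hg, Finsupp.add_apply, coeff_add]
    split_ifs <;> simp
  | single l p =>
    classical
    rw [freeComponent_single, Finsupp.single_apply, Finsupp.single_apply]
    by_cases h : l = j
    · subst h
      rw [if_pos rfl, if_pos rfl, coeff_intComponent]
      congr 1
      rw [eq_sub_iff_add_eq]
    · simp [h]

/-- By additivity only a monomial multiple of a basis element matters, and its image is concentrated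
in the one degree $\deg m + a_l$. -/
lemma IsGradedMap.freeComponent_comm {a : ι → ℤ} {b : κ → ℤ}
    {f : (ι →₀ MvPolynomial (Fin n) k) →ₗ[MvPolynomial (Fin n) k]
      (κ →₀ MvPolynomial (Fin n) k)} (hf : IsGradedMap a b f) (D : ℤ)
    (v : ι →₀ MvPolynomial (Fin n) k) : f (freeComponent a D v) = freeComponent b D (f v) := by
  induction v using Finsupp.induction_linear with
  | zero => simp
  | add f g hf hg => simp only [map_add, hf, hg]
  | single l p =>
    induction p using MvPolynomial.induction_on' with
    | add p q hp hq => simp only [Finsupp.single_add, map_add, hp, hq]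
    | monomial m r =>
      have hs : Finsupp.single l (monomial m r) =
          monomial m r • Finsupp.single l (1 : MvPolynomial (Fin n) k) := by simp
      ext j m'
      rw [coeff_freeComponent, freeComponent_single]
      have hc : intComponent (D - a l) (monomial m r) =
          if (m.degree : ℤ) = D - a l then monomial m r else 0 := by
        ext m''
        rw [coeff_intComponent]
        by_cases h : m = m''
        · subst h; split_ifs <;> simp
        · split_ifs <;> simp [coeff_monomial, h]
      have hne : coeff m' (f (Finsupp.single l (monomial m r)) j) ≠ 0 →
          (m'.degree : ℤ) + b j = m.degree + a l := by
        rw [hs, map_smul, Finsupp.smul_apply, smul_eq_mul, coeff_monomial_mul']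
        split_ifs with hm
        · intro h
          have h1 := hf l j _ (right_ne_zero_of_mul h)
          have h2 : (m' - m + m).degree = m'.degree := by rw [tsub_add_cancel_of_le hm]
          rw [map_add] at h2
          omega
        · simp
      rw [hc]
      by_cases h0 : coeff m' (f (Finsupp.single l (monomial m r)) j) = 0
      · split_ifs <;> simp [h0]
      · have h1 := hne h0
        split_ifs <;> first | rfl | omega | simp

lemma isGradedMap_iff {a : ι → ℤ} {b : κ → ℤ}
    {f : (ι →₀ MvPolynomial (Fin n) k) →ₗ[MvPolynomial (Fin n) k]
      (κ →₀ MvPolynomial (Fin n) k)} :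
    IsGradedMap a b f ↔
      ∀ i, freeComponent b (a i) (f (Finsupp.single i 1)) = f (Finsupp.single i 1) := by
  refine forall_congr' fun i => ⟨fun h => ?_, fun h j m hm => ?_⟩
  · ext j m
    rw [coeff_freeComponent]
    split_ifs with h1
    · rfl
    · by_contra h2
      exact h1 (h j m (Ne.symm h2))
  · rw [← h, coeff_freeComponent] at hm
    by_contra h1
    exact hm (if_neg h1)

lemma IsGradedMap.comp {a : ι → ℤ} {b : κ → ℤ} {c : μ → ℤ}
    {g : (κ →₀ MvPolynomial (Fin n) k) →ₗ[MvPolynomial (Fin n) k]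
      (μ →₀ MvPolynomial (Fin n) k)}
    {f : (ι →₀ MvPolynomial (Fin n) k) →ₗ[MvPolynomial (Fin n) k]
      (κ →₀ MvPolynomial (Fin n) k)}
    (hg : IsGradedMap b c g) (hf : IsGradedMap a b f) : IsGradedMap a c (g ∘ₗ f) := by
  rw [isGradedMap_iff]
  intro i
  rw [LinearMap.comp_apply, ← hg.freeComponent_comm, isGradedMap_iff.1 hf]

lemma IsGradedMap.shift {a : ι → ℤ} {b : κ → ℤ}
    {f : (ι →₀ MvPolynomial (Fin n) k) →ₗ[MvPolynomial (Fin n) k]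
      (κ →₀ MvPolynomial (Fin n) k)}
    (hf : IsGradedMap a b f) (e : ℤ) :
    IsGradedMap (fun i => a i + e) (fun i => b i + e) f := fun i j m hm => by
  have := hf i j m hm
  dsimp only
  omega

/-- Free modules are projective: a map into the range of another one lifts. -/
lemma exists_lift
    {f : (ι →₀ MvPolynomial (Fin n) k) →ₗ[MvPolynomial (Fin n) k]
      (κ →₀ MvPolynomial (Fin n) k)}
    {g : (μ →₀ MvPolynomial (Fin n) k) →ₗ[MvPolynomial (Fin n) k]
      (κ →₀ MvPolynomial (Fin n) k)} (h : ∀ v, f v ∈ LinearMap.range g) :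
    ∃ q : (ι →₀ MvPolynomial (Fin n) k) →ₗ[MvPolynomial (Fin n) k]
      (μ →₀ MvPolynomial (Fin n) k), g ∘ₗ q = f := by
  choose v hv using fun i => h (Finsupp.single i 1)
  refine ⟨Finsupp.linearCombination _ v, ?_⟩
  ext1 i
  ext1
  simp [hv]

/-- Graded free modules are projective among graded modules. -/
lemma IsGradedMap.exists_lift {a : ι → ℤ} {b : κ → ℤ} {c : μ → ℤ}
    {f : (ι →₀ MvPolynomial (Fin n) k) →ₗ[MvPolynomial (Fin n) k]
      (κ →₀ MvPolynomial (Fin n) k)}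
    {g : (μ →₀ MvPolynomial (Fin n) k) →ₗ[MvPolynomial (Fin n) k]
      (κ →₀ MvPolynomial (Fin n) k)} (hf : IsGradedMap a b f) (hg : IsGradedMap c b g)
    (h : ∀ v, f v ∈ LinearMap.range g) :
    ∃ q : (ι →₀ MvPolynomial (Fin n) k) →ₗ[MvPolynomial (Fin n) k]
      (μ →₀ MvPolynomial (Fin n) k), IsGradedMap a c q ∧ g ∘ₗ q = f := by
  choose v hv using fun i => h (Finsupp.single i 1)
  -- An arbitrary preimage is replaced by its component of degree `a i`; this is still a preimage
  -- because `g` commutes with components.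
  refine ⟨Finsupp.linearCombination _ fun i => freeComponent c (a i) (v i),
    fun i j m hm => ?_, ?_⟩
  · rw [Finsupp.linearCombination_single, one_smul, coeff_freeComponent] at hm
    by_contra h1
    exact hm (if_neg h1)
  · ext1 i
    ext1
    simp [hg.freeComponent_comm, hv, isGradedMap_iff.1 hf]

/-- The reduction of a map of free modules modulo the variables. -/
def reduceMap (f : (ι →₀ MvPolynomial (Fin n) k) →ₗ[MvPolynomial (Fin n) k]
      (κ →₀ MvPolynomial (Fin n) k)) : (ι →₀ k) →ₗ[k] (κ →₀ k) :=
  Finsupp.linearCombination k fun b =>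
    (f (Finsupp.single b 1)).mapRange constantCoeff (map_zero _)

lemma reduceMap_mapRange (f : (ι →₀ MvPolynomial (Fin n) k) →ₗ[MvPolynomial (Fin n) k]
      (κ →₀ MvPolynomial (Fin n) k)) (v : ι →₀ MvPolynomial (Fin n) k) :
    reduceMap f (v.mapRange constantCoeff (map_zero _)) =
      (f v).mapRange constantCoeff (map_zero _) := by
  induction v using Finsupp.induction_linear with
  | zero => simp
  | add v w hv hw =>
    rw [Finsupp.mapRange_add (fun _ _ => map_add _ _ _), map_add, map_add,
      Finsupp.mapRange_add (fun _ _ => map_add _ _ _), hv, hw]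
  | single i p =>
    have hs : Finsupp.single i p = p • Finsupp.single i (1 : MvPolynomial (Fin n) k) := by simp
    ext j
    rw [Finsupp.mapRange_single, reduceMap, Finsupp.linearCombination_single, hs, map_smul]
    simp

lemma reduceMap_comp (g : (κ →₀ MvPolynomial (Fin n) k) →ₗ[MvPolynomial (Fin n) k]
      (μ →₀ MvPolynomial (Fin n) k)) (f : (ι →₀ MvPolynomial (Fin n) k) →ₗ[MvPolynomial (Fin n) k]
      (κ →₀ MvPolynomial (Fin n) k)) (v : ι →₀ k) :
    reduceMap (g ∘ₗ f) v = reduceMap g (reduceMap f v) := by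
  rw [← LinearMap.comp_apply]
  congr 1
  refine Finsupp.lhom_ext' fun i => LinearMap.ext_ring ?_
  simp only [LinearMap.comp_apply, Finsupp.lsingle_apply]
  conv_rhs => rw [reduceMap.eq_def f, Finsupp.linearCombination_single, one_smul,
    reduceMap_mapRange]
  rw [reduceMap, Finsupp.linearCombination_single, one_smul, LinearMap.comp_apply]

lemma reduceMap_add (f g : (ι →₀ MvPolynomial (Fin n) k) →ₗ[MvPolynomial (Fin n) k]
      (κ →₀ MvPolynomial (Fin n) k)) : reduceMap (f + g) = reduceMap f + reduceMap g := by
  refine Finsupp.lhom_ext' fun i => LinearMap.ext_ring ?_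
  ext j
  simp [reduceMap]

lemma reduceMap_id : reduceMap (LinearMap.id : (ι →₀ MvPolynomial (Fin n) k)
    →ₗ[MvPolynomial (Fin n) k] _) = LinearMap.id := by
  refine Finsupp.lhom_ext' fun i => LinearMap.ext_ring ?_
  simp [reduceMap]

lemma IsGradedMap.reduceMap_mem {a : ι → ℤ} {b : κ → ℤ}
    {f : (ι →₀ MvPolynomial (Fin n) k) →ₗ[MvPolynomial (Fin n) k]
      (κ →₀ MvPolynomial (Fin n) k)} (hf : IsGradedMap a b f) {D : ℤ} {v : ι →₀ k}
    (hv : v ∈ Finsupp.supported k k {i | a i = D}) :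
    reduceMap f v ∈ Finsupp.supported k k {j | b j = D} := by
  rw [reduceMap, Finsupp.linearCombination_apply]
  refine Submodule.sum_mem _ fun i hi => Submodule.smul_mem _ _ ?_
  rw [Finsupp.mem_supported]
  intro j hj
  have h1 : a i = D := hv hi
  have h2 := hf i j 0 (by
    rw [← constantCoeff_eq]
    simpa using hj)
  simpa [h1] using h2

end GradedMaps

/-! ### Comparison of resolutions and invariance of Betti numbers. -/

namespace GradedFreeResolution

variable {k : Type u} [Field k] {n : ℕ} {I : Ideal (MvPolynomial (Fin n) k)}
  (F : GradedFreeResolution I)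

/-- The bases of the resolution `⋯ → F_1 → F_0 → S` augmented by the polynomial ring. -/
abbrev augι : ℕ → Type u
  | 0 => PUnit
  | i + 1 => F.ι i

/-- The degrees of the bases of the augmented resolution. -/
def augDeg : ∀ i, F.augι i → ℤ
  | 0 => fun _ => 0
  | i + 1 => F.deg i

/-- The differential of the augmented resolution. -/
def augD : ∀ i, (F.augι (i + 1) →₀ MvPolynomial (Fin n) k) →ₗ[MvPolynomial (Fin n) k]
    (F.augι i →₀ MvPolynomial (Fin n) k)
  | 0 => Finsupp.lsingle PUnit.unit ∘ₗ F.ε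
  | i + 1 => F.d i

@[simp]
lemma augD_zero_apply (v : F.ι 0 →₀ MvPolynomial (Fin n) k) :
    F.augD 0 v = Finsupp.single PUnit.unit (F.ε v) := rfl

lemma augD_graded (i : ℕ) : IsGradedMap (F.augDeg (i + 1)) (F.augDeg i) (F.augD i) := by
  cases i with
  | zero =>
    intro b j m hm
    have : coeff m (F.ε (Finsupp.single b 1)) ≠ 0 := by
      cases j
      rwa [augD_zero_apply, Finsupp.single_eq_same] at hm
    simpa [augDeg] using F.ε_homogeneous b m this
  | succ i => exact F.d_homogeneous i

lemma ker_augD (i : ℕ) : LinearMap.ker (F.augD i) = LinearMap.range (F.augD (i + 1)) := by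
  cases i with
  | zero =>
    refine Eq.trans ?_ F.exact_zero
    ext v
    exact Finsupp.single_eq_zero
  | succ i => exact F.exact_succ i

lemma augD_augD (i : ℕ) (v) : F.augD i (F.augD (i + 1) v) = 0 := by
  rw [← LinearMap.mem_ker, ker_augD]
  exact ⟨v, rfl⟩

lemma mem_range_augD_zero (v : F.augι 0 →₀ MvPolynomial (Fin n) k) :
    v ∈ LinearMap.range (F.augD 0) ↔ v PUnit.unit ∈ I := by
  have h : v PUnit.unit ∈ I ↔ v PUnit.unit ∈ LinearMap.range F.ε := by rw [F.range_ε]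
  rw [h]
  refine exists_congr fun w => ⟨fun h => ?_, fun h => ?_⟩
  · rw [← h]
    exact Finsupp.single_eq_same.symm
  · refine Finsupp.ext fun j => ?_
    cases j
    exact Finsupp.single_eq_same.trans h

variable {F}

lemma exists_seq {X : ℕ → Type*} {P : ∀ i, X i → X (i + 1) → Prop} {Q : ∀ i, X i → Prop}
    (x0 : X 0) (h0 : Q 0 x0) (hs : ∀ i x, Q i x → ∃ y, P i x y ∧ Q (i + 1) y) :
    ∃ x : ∀ i, X i, x 0 = x0 ∧ (∀ i, Q i (x i)) ∧ ∀ i, P i (x i) (x (i + 1)) := by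
  choose f hf using hs
  let x : ∀ i, {x : X i // Q i x} := fun i =>
    Nat.rec ⟨x0, h0⟩ (fun i x => ⟨f i x.1 x.2, (hf i x.1 x.2).2⟩) i
  exact ⟨fun i => (x i).1, rfl, fun i => (x i).2, fun i => (hf i _ (x i).2).1⟩

/-- Multiplication by a homogeneous polynomial `f` of degree `e` which sends an ideal `I` into
another ideal `J` lifts to a graded map of the resolutions. -/
lemma exists_chainMap {J : Ideal (MvPolynomial (Fin n) k)} (F : GradedFreeResolution I)
    (G : GradedFreeResolution J) (f : MvPolynomial (Fin n) k) (e : ℕ) (hf : f.IsHomogeneous e)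
    (hIJ : ∀ p ∈ I, f * p ∈ J) :
    ∃ φ : ∀ i, (F.augι i →₀ MvPolynomial (Fin n) k) →ₗ[MvPolynomial (Fin n) k]
        (G.augι i →₀ MvPolynomial (Fin n) k),
      (∀ v, φ 0 v PUnit.unit = f * v PUnit.unit) ∧
      (∀ i, IsGradedMap (fun b => F.augDeg i b + e) (G.augDeg i) (φ i)) ∧
      ∀ i, G.augD i ∘ₗ φ (i + 1) = φ i ∘ₗ F.augD i := by
  let φ0 : (PUnit.{u+1} →₀ MvPolynomial (Fin n) k) →ₗ[MvPolynomial (Fin n) k]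
    (PUnit.{u+1} →₀ MvPolynomial (Fin n) k) := LinearMap.lsmul _ _ f
  have hφ0 : IsGradedMap (fun b => F.augDeg 0 b + e) (G.augDeg 0) φ0 := by
    rintro ⟨⟩ ⟨⟩ m hm
    have h : φ0 (Finsupp.single PUnit.unit 1) PUnit.unit = f := by simp [φ0]
    have hd : m.degree = e := by
      by_contra h'
      exact hm (h ▸ hf.coeff_eq_zero h')
    simp [augDeg, hd]
  obtain ⟨φ, h0, h1, h2⟩ := exists_seq
    (X := fun i => (F.augι i →₀ MvPolynomial (Fin n) k) →ₗ[MvPolynomial (Fin n) k]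
        (G.augι i →₀ MvPolynomial (Fin n) k))
    (P := fun i x y => G.augD i ∘ₗ y = x ∘ₗ F.augD i)
    (Q := fun i x => IsGradedMap (fun b => F.augDeg i b + e) (G.augDeg i) x ∧
      ∀ v, x (F.augD i v) ∈ LinearMap.range (G.augD i)) φ0
    ⟨hφ0, fun v => (G.mem_range_augD_zero _).2
      (hIJ _ ((F.mem_range_augD_zero _).1 ⟨v, rfl⟩))⟩ fun i x ⟨hx, hr⟩ => by
        obtain ⟨y, hy, hxy⟩ :=
          (hx.comp ((F.augD_graded i).shift e)).exists_lift (G.augD_graded i) fun v => hr v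
        refine ⟨y, hxy, hy, fun v => ?_⟩
        rw [← ker_augD, LinearMap.mem_ker, ← LinearMap.comp_apply, hxy, LinearMap.comp_apply,
          augD_augD, map_zero]
  exact ⟨φ, fun v => by rw [h0]; rfl, fun i => (h1 i).1, h2⟩

/-- A chain endomorphism which lifts the identity induces the identity in the homology of the
reduction modulo the variables. -/
lemma reduceMap_sub_mem_boundaries
    (φ : ∀ i, (F.augι i →₀ MvPolynomial (Fin n) k) →ₗ[MvPolynomial (Fin n) k]
        (F.augι i →₀ MvPolynomial (Fin n) k)) (h0 : φ 0 = LinearMap.id)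
    (hφ : ∀ i, F.augD i ∘ₗ φ (i + 1) = φ i ∘ₗ F.augD i) (i : ℕ)
    (z : F.augι (i + 1) →₀ k) (hz : z ∈ F.cycles i) :
    reduceMap (φ (i + 1)) z - z ∈ F.boundaries i := by
  -- A null-homotopy of `φ - id`, built degree by degree. Its first component is zero because `φ 0`
  -- is the identity; this is needed below since `cycles 0` is everything, so the reduced
  -- augmentation need not kill `z`.
  have key : ∀ i, ∃ (h : (F.augι i →₀ MvPolynomial (Fin n) k) →ₗ[MvPolynomial (Fin n) k]
      (F.augι (i + 1) →₀ MvPolynomial (Fin n) k))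
      (h' : (F.augι (i + 1) →₀ MvPolynomial (Fin n) k) →ₗ[MvPolynomial (Fin n) k]
      (F.augι (i + 2) →₀ MvPolynomial (Fin n) k)), (i = 0 → h = 0) ∧
      φ (i + 1) = LinearMap.id + (F.augD (i + 1) ∘ₗ h' + h ∘ₗ F.augD i) := by
    intro i
    induction i with
    | zero =>
      obtain ⟨h', hh⟩ := exists_lift (f := φ 1 - LinearMap.id) (g := F.augD 1) fun v => by
        rw [← ker_augD, LinearMap.mem_ker, LinearMap.sub_apply, map_sub, ← LinearMap.comp_apply,
          hφ, h0]
        simp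
      refine ⟨0, h', fun _ => rfl, ?_⟩
      rw [LinearMap.zero_comp, add_zero, hh]
      abel
    | succ i ih =>
      obtain ⟨h, h', -, hh⟩ := ih
      obtain ⟨h'', hh'⟩ := exists_lift
        (f := φ (i + 2) - LinearMap.id - h' ∘ₗ F.augD (i + 1)) (g := F.augD (i + 2)) fun v => by
          rw [← ker_augD, LinearMap.mem_ker, LinearMap.sub_apply, LinearMap.sub_apply, map_sub,
            map_sub, ← LinearMap.comp_apply, hφ, hh]
          simpa using (congrArg h (F.augD_augD i v)).trans (map_zero h)
      refine ⟨h', h'', by simp, ?_⟩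
      rw [hh']
      abel
  obtain ⟨h, h', hi, hh⟩ := key i
  have h1 : reduceMap (φ (i + 1)) z = z + (reduceMap (F.augD (i + 1)) (reduceMap h' z) +
      reduceMap h (reduceMap (F.augD i) z)) := by
    rw [hh, reduceMap_add, reduceMap_add, reduceMap_id, LinearMap.add_apply, LinearMap.add_apply,
      reduceMap_comp, reduceMap_comp, LinearMap.id_apply]
  have h2 : reduceMap h (reduceMap (F.augD i) z) = 0 := by
    cases i with
    | zero =>
      have h3 : reduceMap (0 : (F.augι 0 →₀ MvPolynomial (Fin n) k) →ₗ[MvPolynomial (Fin n) k]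
          (F.augι 1 →₀ MvPolynomial (Fin n) k)) = 0 := by
        refine Finsupp.lhom_ext' fun i => LinearMap.ext_ring ?_
        simp [reduceMap]
      rw [hi rfl, h3, LinearMap.zero_apply]
    | succ i =>
      have : reduceMap (F.augD (i + 1)) z = 0 := hz
      rw [this, map_zero]
  rw [h1, h2, add_zero, add_sub_cancel_left]
  exact ⟨_, rfl⟩

/-- Lifts `φ : F → G` and `ψ : G → F` of the identity have `ψ ∘ φ` homotopic to the identity, so `ψ`
maps the Tor of `G` onto that of `F`. No finiteness is required, as ranks are compared as cardinals.
-/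
lemma betti_le (F G : GradedFreeResolution I) (i : ℕ) (j : ℤ) : F.betti i j ≤ G.betti i j := by
  obtain ⟨φ, hφ0, hφ, hφd⟩ := exists_chainMap F G 1 0 (isHomogeneous_one _ _) (by simp)
  obtain ⟨ψ, hψ0, hψ, hψd⟩ := exists_chainMap G F 1 0 (isHomogeneous_one _ _) (by simp)
  let B : (G.ι i →₀ k) →ₗ[k] (F.ι i →₀ k) := reduceMap (ψ (i + 1))
  have hB : G.boundaries i ≤ (F.boundaries i).comap B := by
    rintro _ ⟨v, rfl⟩
    have h : reduceMap (ψ (i + 1)) (reduceMap (G.augD (i + 1)) v) =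
        reduceMap (F.augD (i + 1)) (reduceMap (ψ (i + 2)) v) := by
      rw [← reduceMap_comp, ← hψd, reduceMap_comp]
    exact ⟨_, h.symm⟩
  have hle : F.tor i j ≤ (G.tor i j).map (Submodule.mapQ _ _ B hB) := by
    rintro _ ⟨z, ⟨hz, hzj⟩, rfl⟩
    have h1 : reduceMap (φ (i + 1)) z ∈ G.piece i j :=
      (hφ (i + 1)).reduceMap_mem (D := j) (by
        simp only [Nat.cast_zero, add_zero]
        exact hzj)
    have h2 : reduceMap (φ (i + 1)) z ∈ G.cycles i := by
      cases i with
      | zero => exact Submodule.mem_top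
      | succ i =>
        have h : reduceMap (G.augD (i + 1)) (reduceMap (φ (i + 2)) z) =
            reduceMap (φ (i + 1)) (reduceMap (F.augD (i + 1)) z) := by
          rw [← reduceMap_comp, hφd, reduceMap_comp]
        have hz' : reduceMap (F.augD (i + 1)) z = 0 := hz
        rw [hz', map_zero] at h
        exact h
    refine ⟨_, ⟨_, ⟨h2, h1⟩, rfl⟩, ?_⟩
    rw [Submodule.mkQ_apply, Submodule.mapQ_apply, ← sub_eq_zero, Submodule.mkQ_apply,
      ← Submodule.Quotient.mk_sub, Submodule.Quotient.mk_eq_zero]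
    have := reduceMap_sub_mem_boundaries (F := F) (fun i => ψ i ∘ₗ φ i) ?_ ?_ i z hz
    · rwa [reduceMap_comp] at this
    · refine LinearMap.ext fun v => Finsupp.ext fun b => ?_
      cases b
      exact (hψ0 _).trans (by rw [hφ0, one_mul, one_mul]; rfl)
    · intro i
      rw [← LinearMap.comp_assoc, hψd, LinearMap.comp_assoc, hφd, LinearMap.comp_assoc]
  exact (Submodule.rank_mono hle).trans (rank_map_le _ _)

/-- Graded Betti numbers do not depend on the resolution. -/
theorem betti_eq (F G : GradedFreeResolution I) (i : ℕ) (j : ℤ) : F.betti i j = G.betti i j :=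
  le_antisymm (betti_le F G i j) (betti_le G F i j)

/-- The Betti numbers of a minimal resolution are the cardinalities of the bases. -/
theorem betti_eq_card (hF : ∀ i, F.tensorD i = 0) (i : ℕ) (j : ℤ) :
    F.betti i j = Cardinal.mk {b // F.deg i b = j} := by
  have hc : F.cycles i = ⊤ := by
    cases i with
    | zero => rfl
    | succ i => rw [cycles, hF, LinearMap.ker_zero]
  have hb : F.boundaries i = ⊥ := by rw [boundaries, hF, LinearMap.range_zero]
  have hinj : Function.Injective (F.boundaries i).mkQ := by
    rw [← LinearMap.ker_eq_bot, Submodule.ker_mkQ, hb]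
  rw [betti, tor, hc, top_inf_eq,
    ← (Submodule.equivMapOfInjective _ hinj (F.piece i j)).rank_eq, piece,
    (Finsupp.supportedEquivFinsupp _).rank_eq, rank_finsupp_self']
  rfl

end GradedFreeResolution

/-! ### Mapping cones. -/

section ConeMap

variable {S : Type*} [CommRing S] {α β α' β' : Type*}

/-- The map of free modules with block matrix `(d, φ; 0, -δ)`. -/
def coneMap (d : (α →₀ S) →ₗ[S] (α' →₀ S)) (φ : (β →₀ S) →ₗ[S] (α' →₀ S))
    (δ : (β →₀ S) →ₗ[S] (β' →₀ S)) : (α ⊕ β →₀ S) →ₗ[S] (α' ⊕ β' →₀ S) :=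
  (Finsupp.sumFinsuppLEquivProdFinsupp S).symm.toLinearMap ∘ₗ
    ((d.coprod φ).prod (-(δ ∘ₗ LinearMap.snd _ _ _))) ∘ₗ
    (Finsupp.sumFinsuppLEquivProdFinsupp S).toLinearMap

variable (d : (α →₀ S) →ₗ[S] (α' →₀ S)) (φ : (β →₀ S) →ₗ[S] (α' →₀ S))
  (δ : (β →₀ S) →ₗ[S] (β' →₀ S))

lemma coneMap_symm_apply (x : α →₀ S) (y : β →₀ S) :
    coneMap d φ δ ((Finsupp.sumFinsuppLEquivProdFinsupp S).symm (x, y)) =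
      (Finsupp.sumFinsuppLEquivProdFinsupp S).symm (d x + φ y, -δ y) := by
  simp only [coneMap, LinearMap.comp_apply, LinearEquiv.coe_coe, LinearEquiv.apply_symm_apply]
  rfl

@[simp]
lemma coneMap_inl_inl (b : α) (b' : α') :
    coneMap d φ δ (Finsupp.single (Sum.inl b) 1) (Sum.inl b') = d (Finsupp.single b 1) b' := by
  simp [coneMap]

@[simp]
lemma coneMap_inl_inr (b : α) (b' : β') :
    coneMap d φ δ (Finsupp.single (Sum.inl b) 1) (Sum.inr b') = 0 := by
  simp [coneMap]

@[simp]
lemma coneMap_inr_inl (b : β) (b' : α') :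
    coneMap d φ δ (Finsupp.single (Sum.inr b) 1) (Sum.inl b') = φ (Finsupp.single b 1) b' := by
  simp [coneMap]

@[simp]
lemma coneMap_inr_inr (b : β) (b' : β') :
    coneMap d φ δ (Finsupp.single (Sum.inr b) 1) (Sum.inr b') = -δ (Finsupp.single b 1) b' := by
  simp [coneMap]

lemma mem_ker_coneMap (x : α →₀ S) (y : β →₀ S) :
    (Finsupp.sumFinsuppLEquivProdFinsupp S).symm (x, y) ∈ LinearMap.ker (coneMap d φ δ) ↔
      d x + φ y = 0 ∧ δ y = 0 := by
  rw [LinearMap.mem_ker, coneMap_symm_apply, LinearEquiv.map_eq_zero_iff, Prod.mk_eq_zero,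
    neg_eq_zero]

lemma mem_range_coneMap (x : α' →₀ S) (y : β' →₀ S) :
    (Finsupp.sumFinsuppLEquivProdFinsupp S).symm (x, y) ∈ LinearMap.range (coneMap d φ δ) ↔
      ∃ a b, d a + φ b = x ∧ -δ b = y := by
  rw [LinearMap.mem_range, (Finsupp.sumFinsuppLEquivProdFinsupp S).symm.surjective.exists,
    Prod.exists]
  simp only [coneMap_symm_apply, EmbeddingLike.apply_eq_iff_eq, Prod.mk.injEq]

end ConeMap

namespace GradedFreeResolution

variable {k : Type u} [Field k] {n : ℕ} {I Q : Ideal (MvPolynomial (Fin n) k)}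

lemma tensorD_eq_zero_iff (F : GradedFreeResolution I) (i : ℕ) :
    F.tensorD i = 0 ↔ ∀ b b', constantCoeff (F.d i (Finsupp.single b 1) b') = 0 := by
  refine ⟨fun h b b' => ?_, fun h => Finsupp.lhom_ext' fun b => LinearMap.ext_ring ?_⟩
  · have := DFunLike.congr_fun (LinearMap.congr_fun h (Finsupp.single b 1)) b'
    simpa [tensorD] using this
  · ext b'
    simpa [tensorD] using h b b'

/-- The mapping cone of a map lifting the multiplication by `f` from the colon ideal `Q = I : f`
to `I`; it resolves `I + (f)`. -/
def cone (F : GradedFreeResolution I) (K : GradedFreeResolution Q)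
    (f : MvPolynomial (Fin n) k) (e : ℕ) (hf : f.IsHomogeneous e) (hQ : ∀ p, f * p ∈ I ↔ p ∈ Q)
    (φ : ∀ i, (K.augι i →₀ MvPolynomial (Fin n) k) →ₗ[MvPolynomial (Fin n) k]
        (F.augι i →₀ MvPolynomial (Fin n) k))
    (hφ0 : ∀ v, φ 0 v PUnit.unit = f * v PUnit.unit)
    (hφ : ∀ i, IsGradedMap (fun b => K.augDeg i b + e) (F.augDeg i) (φ i))
    (hφd : ∀ i, F.augD i ∘ₗ φ (i + 1) = φ i ∘ₗ K.augD i) :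
    GradedFreeResolution (I ⊔ Ideal.span {f}) where
  -- The augmented bases provide the shift by one: `augι 0` is the single new generator, sent to
  -- `f`, and `K.ι i` enters in homological degree `i + 1`.
  ι i := F.ι i ⊕ K.augι i
  deg i := Sum.elim (F.deg i) fun b => K.augDeg i b + e
  d i := coneMap (F.d i) (φ (i + 1)) (K.augD i)
  ε := (F.ε.coprod (LinearMap.toSpanSingleton _ _ f ∘ₗ Finsupp.lapply PUnit.unit)) ∘ₗ
    (Finsupp.sumFinsuppLEquivProdFinsupp _).toLinearMap
  d_homogeneous i b b' m hm := by
    rcases b with b | b <;> rcases b' with b' | b'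
    · rw [coneMap_inl_inl] at hm
      exact F.d_homogeneous i b b' m hm
    · rw [coneMap_inl_inr, coeff_zero] at hm
      exact absurd rfl hm
    · rw [coneMap_inr_inl] at hm
      exact hφ (i + 1) b b' m hm
    · rw [coneMap_inr_inr, coeff_neg, neg_ne_zero] at hm
      have := K.augD_graded i b b' m hm
      dsimp only [Sum.elim_inr]
      omega
  ε_homogeneous b m hm := by
    rcases b with b | b
    · simp at hm
      exact F.ε_homogeneous b m hm
    · obtain ⟨⟩ := b
      simp at hm
      have hd : m.degree = e := by
        by_contra h
        exact hm (hf.coeff_eq_zero h)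
      simp [augDeg, hd]
  range_ε := by
    rw [LinearMap.range_comp, LinearEquiv.range, Submodule.map_top, LinearMap.range_coprod,
      F.range_ε, LinearMap.range_comp]
    congr 1
    have : LinearMap.range (Finsupp.lapply (R := MvPolynomial (Fin n) k)
        (M := MvPolynomial (Fin n) k) (PUnit.unit : K.augι 0)) = ⊤ :=
      LinearMap.range_eq_top.2 fun p => ⟨Finsupp.single PUnit.unit p, by simp⟩
    rw [this, Submodule.map_top, LinearMap.range_toSpanSingleton]
  exact_zero := by
    ext v
    obtain ⟨⟨x, y⟩, rfl⟩ := (Finsupp.sumFinsuppLEquivProdFinsupp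
      (MvPolynomial (Fin n) k)).symm.surjective v
    have h0 : ∀ w, K.augD 0 w PUnit.unit = K.ε w := fun w => by
      rw [augD_zero_apply, Finsupp.single_eq_same]
    have h1 : ∀ w, F.ε (φ 1 w) = f * K.ε w := fun w => by
      have := DFunLike.congr_fun (LinearMap.congr_fun (hφd 0) w) PUnit.unit
      rw [LinearMap.comp_apply, LinearMap.comp_apply, hφ0, h0] at this
      rw [← this, augD_zero_apply, Finsupp.single_eq_same]
    rw [mem_range_coneMap, LinearMap.mem_ker, LinearMap.comp_apply, LinearEquiv.coe_coe,
      LinearEquiv.apply_symm_apply]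
    change F.ε x + y PUnit.unit * f = 0 ↔ _
    constructor
    · intro h
      -- A syzygy expresses `y * f` by elements of `I`, so its last coordinate lies in the colon
      -- ideal.
      have hy : y PUnit.unit ∈ Q := by
        rw [← hQ, mul_comm, ← F.range_ε]
        exact ⟨-x, by rw [map_neg]; linear_combination -h⟩
      rw [← K.mem_range_augD_zero] at hy
      obtain ⟨w, rfl⟩ := hy
      have hx : x + φ 1 w ∈ LinearMap.ker F.ε := by
        rw [LinearMap.mem_ker, map_add, h1, ← h0]
        linear_combination h
      rw [F.exact_zero] at hx
      obtain ⟨z, hz⟩ := hx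
      exact ⟨z, -w, by rw [hz, map_neg, add_neg_cancel_right], by rw [map_neg, neg_neg]⟩
    · rintro ⟨a, b, rfl, rfl⟩
      have h2 : F.ε (F.d 0 a) = 0 := by
        rw [← LinearMap.mem_ker, F.exact_zero]
        exact ⟨a, rfl⟩
      rw [map_add, h1, h2, Finsupp.neg_apply, h0]
      ring
  exact_succ i := by
    ext v
    obtain ⟨⟨x, y⟩, rfl⟩ := (Finsupp.sumFinsuppLEquivProdFinsupp
      (MvPolynomial (Fin n) k)).symm.surjective v
    have h1 : ∀ w, F.d i (φ (i + 2) w) = φ (i + 1) (K.augD (i + 1) w) := fun w =>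
      LinearMap.congr_fun (hφd (i + 1)) w
    rw [mem_ker_coneMap, mem_range_coneMap]
    constructor
    · rintro ⟨hx, hy⟩
      rw [← LinearMap.mem_ker, K.ker_augD] at hy
      obtain ⟨w, rfl⟩ := hy
      rw [← h1, ← map_add, ← LinearMap.mem_ker, F.exact_succ] at hx
      obtain ⟨z, hz⟩ := hx
      exact ⟨z, -w, by rw [hz, map_neg, add_neg_cancel_right], by rw [map_neg, neg_neg]⟩
    · rintro ⟨a, b, rfl, rfl⟩
      have h2 : F.d i (F.d (i + 1) a) = 0 := by
        rw [← LinearMap.mem_ker, F.exact_succ]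
        exact ⟨a, rfl⟩
      refine ⟨?_, ?_⟩
      · rw [map_add, h2, h1, map_neg, zero_add, add_neg_cancel]
      · rw [map_neg, K.augD_augD, neg_zero]

end GradedFreeResolution

/-! ### Minimal resolutions from linear quotients. -/

open GradedFreeResolution

variable {k : Type u} [Field k] {n : ℕ} {I Q : Ideal (MvPolynomial (Fin n) k)}

/-- `I` has a minimal graded free resolution whose `i`-th module has generators of degree at most
`i + e`, with exactly `N i j` of them in degree `i + j`. -/
def HasMinimalResolution (I : Ideal (MvPolynomial (Fin n) k)) (e : ℕ) (N : ℕ → ℤ → ℕ) : Prop :=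
  ∃ F : GradedFreeResolution I, (∀ i, F.tensorD i = 0) ∧ (∀ i b, F.deg i b ≤ i + e) ∧
    ∀ (i : ℕ) (j : ℤ), Cardinal.mk {b // F.deg i b = i + j} = N i j

/-- `I` has a minimal graded free resolution with the Betti numbers of the Koszul complex of `t`
variables. -/
def HasKoszulResolution (I : Ideal (MvPolynomial (Fin n) k)) (t : ℕ) : Prop :=
  ∃ K : GradedFreeResolution I, (∀ i, K.tensorD i = 0) ∧ (∀ i b, K.deg i b = i + 1) ∧
    ∀ i, Cardinal.mk (K.ι i) = t.choose (i + 1)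

/-- Only the block of the comparison map is in doubt. It goes from generators of degree $i+1+e$ to
generators of degree at most $i+e$, whereas a nonzero constant entry would force equal degrees. -/
lemma tensorD_cone (F : GradedFreeResolution I) (K : GradedFreeResolution Q)
    (f : MvPolynomial (Fin n) k) (e : ℕ) (hf hQ φ hφ0 hφ hφd)
    (hF : ∀ i, F.tensorD i = 0) (hFe : ∀ i b, F.deg i b ≤ i + e)
    (hK : ∀ i, K.tensorD i = 0) (hKd : ∀ i b, K.deg i b = i + 1) (i : ℕ) :
    (cone F K f e hf hQ φ hφ0 hφ hφd).tensorD i = 0 := by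
  rw [tensorD_eq_zero_iff]
  rintro (b | b) (b' | b')
  · exact (congrArg _ (coneMap_inl_inl _ _ _ b b')).trans ((tensorD_eq_zero_iff F i).1 (hF i) b b')
  · exact (congrArg _ (coneMap_inl_inr _ _ _ b b')).trans (map_zero _)
  · refine (congrArg _ (coneMap_inr_inl _ _ _ b b')).trans ?_
    by_contra h
    have h1 := hφ (i + 1) b b' 0 h
    have h2 := hFe i b'
    have h3 := hKd i b
    simp only [augDeg, map_zero] at h1
    omega
  · have h0 : coeff 0 (K.augD i (Finsupp.single b 1) b') = 0 := by
      cases i with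
      | zero =>
        by_contra h
        have h1 := K.augD_graded 0 b b' 0 h
        have h3 := hKd 0 b
        simp only [augDeg, map_zero] at h1
        omega
      | succ i => exact (tensorD_eq_zero_iff K i).1 (hK i) b b'
    refine (congrArg _ (coneMap_inr_inr _ _ _ b b')).trans ?_
    rw [map_neg, constantCoeff_eq, h0, neg_zero]

/-- The inductive step of the linear quotients argument. The augmented resolution of `Q` has
$\binom{t}{i}$ generators at index $i$, all of degree $i$, which the cone shifts to degree $i+e'$.
-/
theorem HasMinimalResolution.add {e e' : ℕ} {N : ℕ → ℤ → ℕ} (hI : HasMinimalResolution I e N)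
    (hee : e ≤ e') {t : ℕ} (hQ : HasKoszulResolution Q t) {f : MvPolynomial (Fin n) k}
    (hf : f.IsHomogeneous e') (hIQ : ∀ p, f * p ∈ I ↔ p ∈ Q) :
    HasMinimalResolution (I ⊔ Ideal.span {f}) e'
      fun i j => N i j + if j = e' then t.choose i else 0 := by
  obtain ⟨F, hF, hFe, hFN⟩ := hI
  obtain ⟨K, hK, hKd, hKt⟩ := hQ
  obtain ⟨φ, hφ0, hφ, hφd⟩ := exists_chainMap K F f e' hf fun p => (hIQ p).2
  have hdeg : ∀ i (b : K.augι i), K.augDeg i b = i := by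
    rintro (_ | i) b
    · rfl
    · simp [augDeg, hKd]
  have hcard : ∀ i, Cardinal.mk (K.augι i) = t.choose i := by
    rintro (_ | i)
    · simp
    · exact hKt i
  refine ⟨cone F K f e' hf hIQ φ hφ0 hφ hφd,
    tensorD_cone F K f e' hf hIQ φ hφ0 hφ hφd hF ?_ hK hKd, ?_, fun i j => ?_⟩
  · intro i b
    have := hFe i b
    omega
  · rintro i (b | b)
    · have := hFe i b
      change F.deg i b ≤ _
      omega
    · exact (congrArg (· + (e' : ℤ)) (hdeg i b)).le
  · refine (Cardinal.mk_congr (Equiv.subtypeSum (α := F.ι i) (β := K.augι i)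
      (p := fun b => (cone F K f e' hf hIQ φ hφ0 hφ hφd).deg i b = i + j))).trans ?_
    rw [Cardinal.mk_sum, Cardinal.lift_id, Cardinal.lift_id, Nat.cast_add]
    congr 1
    · exact hFN i j
    · have h : ∀ b : K.augι i, (cone F K f e' hf hIQ φ hφ0 hφ hφd).deg i (Sum.inr b) = i + j ↔
          j = e' := fun b => by
        change K.augDeg i b + (e' : ℤ) = i + j ↔ _
        rw [hdeg]
        omega
      split_ifs with hj
      · rw [Cardinal.mk_congr (Equiv.subtypeUnivEquiv fun b => (h b).2 hj), hcard]
      · have : IsEmpty {b // (cone F K f e' hf hIQ φ hφ0 hφ hφd).deg i (Sum.inr b) = i + j} :=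
          ⟨fun b => hj ((h b.1).1 b.2)⟩
        simp

lemma hasMinimalResolution_bot (e : ℕ) :
    HasMinimalResolution (⊥ : Ideal (MvPolynomial (Fin n) k)) e fun _ _ => 0 := by
  refine ⟨⟨fun _ => PEmpty, fun _ b => b.elim, fun _ => 0, 0, fun _ b => b.elim,
    fun b => b.elim, LinearMap.range_zero, Subsingleton.elim _ _,
    fun _ => Subsingleton.elim _ _⟩, fun i => ?_, fun _ b => b.elim, fun i j => ?_⟩
  · rw [tensorD_eq_zero_iff]
    exact fun b => b.elim
  · have : IsEmpty {b : PEmpty.{u+1} // (b.elim : ℤ) = i + j} := ⟨fun b => b.1.elim⟩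
    simp

lemma HasMinimalResolution.mono {e e' : ℕ} {N : ℕ → ℤ → ℕ} (h : HasMinimalResolution I e N)
    (he : e ≤ e') : HasMinimalResolution I e' N := by
  obtain ⟨F, h1, h2, h3⟩ := h
  refine ⟨F, h1, fun i b => ?_, h3⟩
  have := h2 i b
  omega

lemma HasMinimalResolution.congr {e : ℕ} {N N' : ℕ → ℤ → ℕ} (h : HasMinimalResolution I e N)
    (hN : ∀ i j, N i j = N' i j) : HasMinimalResolution I e N' := by
  rwa [show N' = N from funext₂ fun i j => (hN i j).symm]

lemma HasMinimalResolution.hasKoszulResolution {e t : ℕ}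
    (h : HasMinimalResolution I e fun i j => if j = 1 then t.choose (i + 1) else 0) :
    HasKoszulResolution I t := by
  obtain ⟨F, h1, -, h3⟩ := h
  have hd : ∀ i b, F.deg i b = i + 1 := fun i b => by
    by_contra hb
    have := h3 i (F.deg i b - i)
    dsimp only at this
    rw [if_neg (by omega), Nat.cast_zero, Cardinal.mk_eq_zero_iff] at this
    exact this.false ⟨b, by ring⟩
  refine ⟨F, h1, hd, fun i => ?_⟩
  have := h3 i 1
  dsimp only at this
  rwa [if_pos rfl, Cardinal.mk_congr (Equiv.subtypeUnivEquiv fun b => hd i b)] at this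

/-- Membership in a monomial ideal is tested on the support, so a colon ideal by a monomial can be
computed on exponents alone. -/
lemma monomial_mul_mem_span_iff {E : Set (Fin n →₀ ℕ)} {T : Finset (Fin n)} {m : Fin n →₀ ℕ}
    (h : ∀ a, (∃ s ∈ E, s ≤ m + a) ↔ ∃ i ∈ T, a i ≠ 0) (p : MvPolynomial (Fin n) k) :
    monomial m 1 * p ∈ Ideal.span ((fun s => monomial s (1 : k)) '' E) ↔
      p ∈ Ideal.span (X '' (T : Set (Fin n))) := by
  rw [mem_ideal_span_monomial_image, mem_ideal_span_X_image]
  constructor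
  · intro hp a ha
    refine (h a).1 (hp (m + a) ?_)
    rwa [mem_support_iff, coeff_monomial_mul, one_mul, ← mem_support_iff]
  · intro hp a ha
    rw [mem_support_iff, coeff_monomial_mul'] at ha
    split_ifs at ha with hm
    · rw [one_mul, ← mem_support_iff] at ha
      rw [← add_tsub_cancel_of_le hm]
      exact (h _).2 (hp _ ha)
    · exact absurd rfl ha

/-- A new variable is a nonzerodivisor modulo the old ones: the colon ideal is the old ideal itself,
so the induction hypothesis serves both ends of the cone and Pascal's rule gives the count. -/
lemma hasKoszulResolution_span_X (T : Finset (Fin n)) :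
    HasKoszulResolution (Ideal.span (X '' (T : Set (Fin n))) : Ideal (MvPolynomial (Fin n) k))
      T.card := by
  suffices H : HasMinimalResolution
      (Ideal.span (X '' (T : Set (Fin n))) : Ideal (MvPolynomial (Fin n) k)) 1
      fun i j => if j = 1 then T.card.choose (i + 1) else 0 from H.hasKoszulResolution
  induction T using Finset.induction_on with
  | empty => simpa using hasMinimalResolution_bot 1
  | insert i T hi ih =>
    have hE : (X '' (T : Set (Fin n)) : Set (MvPolynomial (Fin n) k)) =
        (fun s => monomial s (1 : k)) '' ((fun i => Finsupp.single i 1) '' (T : Set (Fin n))) := by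
      rw [Set.image_image]
      rfl
    have h := ih.add le_rfl ih.hasKoszulResolution (isHomogeneous_X k i) fun p => by
      nth_rw 1 [hE]
      refine monomial_mul_mem_span_iff (fun a => ?_) p
      simp only [Set.exists_mem_image, Finset.mem_coe]
      refine exists_congr fun j => and_congr_right fun hj => ?_
      have hij : i ≠ j := fun h => hi (h ▸ hj)
      simp [hij, Nat.one_le_iff_ne_zero]
    rw [Finset.coe_insert, Set.image_insert_eq, Ideal.span_insert, sup_comm]
    refine h.congr fun l j => ?_
    rw [Finset.card_insert_of_notMem hi, Nat.choose_succ_succ' _ l]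
    simp only [Nat.cast_one]
    split_ifs <;> omega

/-- Adding to a monomial ideal monomials of the same degree with linear colon ideals. -/
theorem HasMinimalResolution.add_monomials {e e' : ℕ} {N : ℕ → ℤ → ℕ} {E : Set (Fin n →₀ ℕ)}
    (h : HasMinimalResolution (Ideal.span ((fun s => monomial s (1 : k)) '' E)) e N)
    (hee : e ≤ e') (B : Finset (Fin n →₀ ℕ)) (T : (Fin n →₀ ℕ) → Finset (Fin n))
    (hdeg : ∀ m ∈ B, m.degree = e')
    (hE : ∀ m ∈ B, ∀ s ∈ E, ∀ a, s ≤ m + a → ∃ i ∈ T m, a i ≠ 0)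
    (hB : ∀ m ∈ B, ∀ s ∈ B, s ≠ m → ∀ a, s ≤ m + a → ∃ i ∈ T m, a i ≠ 0)
    (hT : ∀ m ∈ B, ∀ i ∈ T m, ∃ s ∈ E, s ≤ m + Finsupp.single i 1) :
    HasMinimalResolution (Ideal.span ((fun s => monomial s (1 : k)) '' (E ∪ B))) e'
      fun i j => N i j + if j = e' then ∑ m ∈ B, (T m).card.choose i else 0 := by
  -- The order within `B` is irrelevant: `hT` obtains all variables of the colon ideal from `E`
  -- alone, while `hE` and `hB` bound it above for every subset of `B`.
  induction B using Finset.induction_on with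
  | empty => simpa using h.mono hee
  | insert m B hm ih =>
    have h1 := ih (fun m' h' => hdeg m' (Finset.mem_insert_of_mem h'))
      (fun m' h' => hE m' (Finset.mem_insert_of_mem h'))
      (fun m' h' s hs => hB m' (Finset.mem_insert_of_mem h') s (Finset.mem_insert_of_mem hs))
      (fun m' h' => hT m' (Finset.mem_insert_of_mem h'))
    have hmB := Finset.mem_insert_self m B
    have h2 := h1.add le_rfl (hasKoszulResolution_span_X (T m))
      (isHomogeneous_monomial (1 : k) (hdeg m hmB)) fun p => by
        refine monomial_mul_mem_span_iff (fun a => ⟨?_, ?_⟩) p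
        · rintro ⟨s, hs | hs, hsa⟩
          · exact hE m hmB s hs a hsa
          · exact hB m hmB s (Finset.mem_insert_of_mem hs) (fun h => hm (h ▸ hs)) a hsa
        · rintro ⟨i, hi, hai⟩
          obtain ⟨s, hs, hsi⟩ := hT m hmB i hi
          refine ⟨s, Or.inl hs, hsi.trans (add_le_add_right ?_ m)⟩
          rw [Finsupp.single_le_iff]
          omega
    rw [Finset.coe_insert, Set.union_insert, Set.image_insert_eq, Ideal.span_insert, sup_comm]
    refine h2.congr fun i j => ?_
    rw [Finset.sum_insert hm]
    split_ifs <;> omega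

/-! ### Monomial generators of the symbolic square. -/

section Combinatorics

variable {n : ℕ}

/-- The exponent of the squarefree monomial with support `A`. -/
def indExp (A : Finset (Fin n)) : Fin n →₀ ℕ :=
  Finsupp.equivFunOnFinite.symm fun i => if i ∈ A then 1 else 0

lemma indExp_apply (A : Finset (Fin n)) (i : Fin n) : indExp A i = if i ∈ A then 1 else 0 := rfl

lemma degree_indExp (A : Finset (Fin n)) : (indExp A).degree = A.card := by
  rw [Finsupp.degree_eq_sum]
  simp [indExp_apply]

lemma indExp_injective : Function.Injective (indExp (n := n)) := fun A B h => by
  ext i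
  have := DFunLike.congr_fun h i
  rw [indExp_apply, indExp_apply] at this
  split_ifs at this <;> simp_all

/-- Exponents of the squarefree monomials of degree `r` in the first `p` variables. -/
def squarefreeExps (n r p : ℕ) : Set (Fin n →₀ ℕ) :=
  {s | ∃ A : Finset (Fin n), A.card = r ∧ (∀ i ∈ A, i.val < p) ∧ s = indExp A}

/-- Exponents of the squares of the squarefree monomials of degree `d`. -/
def squareExps (n d : ℕ) : Finset (Fin n →₀ ℕ) :=
  (Finset.powersetCard d Finset.univ).image fun A => 2 • indExp A

lemma exists_mem_of_indExp_le {A B : Finset (Fin n)} {r : ℕ} {a : Fin n →₀ ℕ}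
    (h : indExp B ≤ r • indExp A + a) (hBA : ¬ B ⊆ A) : ∃ i ∈ B, i ∉ A ∧ a i ≠ 0 := by
  obtain ⟨i, hi, hiA⟩ := Finset.not_subset.1 hBA
  refine ⟨i, hi, hiA, ?_⟩
  have := h i
  simp only [Finsupp.add_apply, Finsupp.smul_apply, indExp_apply, hi, hiA, if_true, if_false,
    smul_eq_mul] at this
  omega

/-- Generators satisfy the condition because $|A\cap B|\ge |A|+|B|-n$. Conversely, if the support of
$m$ has at most $n-c+1$ elements and fewer than $n-c+1$ exponents are at least $2$, then $c-1$ zeros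
of $m$ together with one more index of exponent at most $1$ form a $c$-set of sum at most $1$. -/
lemma exists_le_iff {c : ℕ} (hc : 2 ≤ c) (hcn : c ≤ n) (m : Fin n →₀ ℕ) :
    (∃ s ∈ squarefreeExps n (n - c + 2) n ∪ (squareExps n (n - c + 1) : Set (Fin n →₀ ℕ)),
      s ≤ m) ↔ ∀ A : Finset (Fin n), A.card = c → 2 ≤ ∑ i ∈ A, m i := by
  have hsum : ∀ (A B : Finset (Fin n)), ∑ i ∈ A, indExp B i = (A ∩ B).card := fun A B => by
    simp only [indExp_apply, Finset.sum_ite_mem, Finset.sum_const, smul_eq_mul, mul_one]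
  have hcard : ∀ (A B : Finset (Fin n)), A.card + B.card ≤ n + (A ∩ B).card := fun A B => by
    rw [← Finset.card_union_add_card_inter]
    have := Finset.card_le_univ (A ∪ B)
    rw [Fintype.card_fin] at this
    omega
  constructor
  · rintro ⟨s, hs, hsm⟩ A hA
    refine le_trans ?_ (Finset.sum_le_sum fun i _ => hsm i)
    rcases hs with ⟨B, hB, -, rfl⟩ | hs
    · have := hcard A B
      rw [hsum]
      omega
    · obtain ⟨B, hB, rfl⟩ := Finset.mem_image.1 hs
      have := hcard A B
      rw [(Finset.mem_powersetCard.1 hB).2] at this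
      simp only [Finsupp.smul_apply, smul_eq_mul]
      rw [← Finset.mul_sum, hsum]
      omega
  · intro h
    by_cases h1 : n - c + 2 ≤ m.support.card
    · obtain ⟨B, hB, hBc⟩ := Finset.exists_subset_card_eq h1
      refine ⟨indExp B, Or.inl ⟨B, hBc, fun i _ => i.2, rfl⟩, fun i => ?_⟩
      rw [indExp_apply]
      split_ifs with hi
      · have := Finsupp.mem_support_iff.1 (hB hi)
        omega
      · omega
    · have h2 : n - c + 1 ≤ (Finset.univ.filter fun i => 2 ≤ m i).card := by
        by_contra h2
        have h3 := Finset.card_compl (Finset.univ.filter fun i => 2 ≤ m i)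
        have h4 := Finset.card_compl m.support
        rw [Fintype.card_fin] at h3 h4
        obtain ⟨Z, hZ, hZc⟩ := Finset.exists_subset_card_eq (s := m.supportᶜ) (n := c - 1)
          (by omega)
        have hZW : Z ⊆ (Finset.univ.filter fun i => 2 ≤ m i)ᶜ := fun i hi => by
          have := hZ hi
          simp only [Finset.mem_compl, Finsupp.mem_support_iff, not_not] at this
          simp [this]
        obtain ⟨A, hZA, hAW, hAc⟩ := Finset.exists_subsuperset_card_eq hZW (n := c) (by omega)
          (by omega)
        have h5 := h A hAc
        rw [← Finset.sum_sdiff hZA, Finset.sum_eq_zero (s := Z) fun i hi => by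
          simpa using hZ hi] at h5
        have h6 : ∑ i ∈ A \ Z, m i ≤ (A \ Z).card • 1 := Finset.sum_le_card_nsmul _ _ _ fun i hi => by
          have := hAW (Finset.sdiff_subset hi)
          simp at this
          omega
        rw [Finset.card_sdiff_of_subset hZA, smul_eq_mul] at h6
        omega
      obtain ⟨B, hB, hBc⟩ := Finset.exists_subset_card_eq h2
      refine ⟨2 • indExp B, Or.inr (Finset.mem_coe.2 (Finset.mem_image.2
        ⟨B, Finset.mem_powersetCard.2 ⟨Finset.subset_univ _, hBc⟩, rfl⟩)), fun i => ?_⟩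
      rw [Finsupp.smul_apply, indExp_apply]
      split_ifs with hi
      · have := hB hi
        simpa using this
      · simp

end Combinatorics

/-! ### Linear quotients for the two families of generators. -/

section Resolution

variable {k : Type u} [Field k] {n : ℕ}

/-- Monomials are added by their largest variable. For $x_P x_A$ with $A$ below $P$, the colon ideal
is generated by the variables below $P$ outside $A$: exchanging $P$ for such a variable gives an
earlier generator. -/
lemma hasMinimalResolution_squarefree (d p : ℕ) (hp : p ≤ n) :
    HasMinimalResolution
      (Ideal.span ((fun s => monomial s (1 : k)) '' squarefreeExps n (d + 1) p)) (d + 1)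
      fun i j => if j = (d + 1 : ℕ) then p.choose (d + 1 + i) * (d + i).choose i else 0 := by
  induction p with
  | zero =>
    have : squarefreeExps n (d + 1) 0 = ∅ := by
      refine Set.eq_empty_of_forall_notMem ?_
      rintro s ⟨A, hA, hA', -⟩
      obtain ⟨i, hi⟩ := Finset.card_pos.1 (by omega : 0 < A.card)
      exact absurd (hA' i hi) (by omega)
    rw [this, Set.image_empty, Ideal.span_empty]
    refine (hasMinimalResolution_bot _).congr fun i j => ?_
    rw [Nat.choose_eq_zero_of_lt (by omega), zero_mul, ite_self]
  | succ p ih =>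
    let P : Fin n := ⟨p, hp⟩
    have hcI : (Finset.Iio P).card = p := by simp [P]
    let B : Finset (Fin n →₀ ℕ) :=
      (Finset.powersetCard d (Finset.Iio P)).image fun A => indExp (insert P A)
    have hPA : ∀ {A : Finset (Fin n)}, A ⊆ Finset.Iio P → P ∉ A := fun hA hP => by
      simpa using hA hP
    have hB : ∀ m ∈ B, ∃ A : Finset (Fin n), A ⊆ Finset.Iio P ∧ A.card = d ∧
        m = indExp (insert P A) := by
      intro m hm
      obtain ⟨A, hA, rfl⟩ := Finset.mem_image.1 hm
      rw [Finset.mem_powersetCard] at hA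
      exact ⟨A, hA.1, hA.2, rfl⟩
    let T : (Fin n →₀ ℕ) → Finset (Fin n) := fun m => (Finset.Iio P).filter fun i => m i = 0
    have hT : ∀ {A : Finset (Fin n)}, A ⊆ Finset.Iio P →
        T (indExp (insert P A)) = Finset.Iio P \ A := fun {A} hA => by
      ext i
      simp only [T, Finset.mem_filter, Finset.mem_sdiff, indExp_apply, Finset.mem_insert]
      refine and_congr_right fun hi => ?_
      rw [Finset.mem_Iio] at hi
      simp [hi.ne]
    have key : ∀ {A A' : Finset (Fin n)}, A ⊆ Finset.Iio P → (∀ i ∈ A', i ≤ P) → ¬ A' ⊆ insert P A →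
        ∀ a, indExp A' ≤ indExp (insert P A) + a → ∃ i ∈ T (indExp (insert P A)), a i ≠ 0 := by
      intro A A' hA hA' hAA a ha
      obtain ⟨i, hi, hi', hia⟩ := exists_mem_of_indExp_le (r := 1) (by simpa using ha) hAA
      rw [Finset.mem_insert, not_or] at hi'
      refine ⟨i, ?_, hia⟩
      rw [hT hA, Finset.mem_sdiff, Finset.mem_Iio]
      exact ⟨lt_of_le_of_ne (hA' i hi) hi'.1, hi'.2⟩
    have h := (ih (by omega)).add_monomials le_rfl B T ?_ ?_ ?_ ?_
    · have hE : squarefreeExps n (d + 1) p ∪ (B : Set (Fin n →₀ ℕ)) =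
          squarefreeExps n (d + 1) (p + 1) := by
        ext s
        constructor
        · rintro (⟨A, hA, hA', rfl⟩ | hs)
          · exact ⟨A, hA, fun i hi => (hA' i hi).trans (Nat.lt_succ_self p), rfl⟩
          · obtain ⟨A, hA, hAc, rfl⟩ := hB s hs
            refine ⟨_, by rw [Finset.card_insert_of_notMem (hPA hA), hAc], fun i hi => ?_, rfl⟩
            rcases Finset.mem_insert.1 hi with rfl | hi
            · exact Nat.lt_succ_self p
            · exact Nat.lt_succ_of_lt (Fin.lt_def.1 (Finset.mem_Iio.1 (hA hi)))
        · rintro ⟨A, hA, hA', rfl⟩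
          by_cases hPm : P ∈ A
          · refine Or.inr (Finset.mem_coe.2 (Finset.mem_image.2 ⟨A.erase P, ?_, ?_⟩))
            · rw [Finset.mem_powersetCard, Finset.card_erase_of_mem hPm, hA]
              refine ⟨fun i hi => ?_, by omega⟩
              rw [Finset.mem_erase] at hi
              rw [Finset.mem_Iio]
              exact lt_of_le_of_ne (Nat.lt_succ_iff.1 (hA' i hi.2)) hi.1
            · rw [Finset.insert_erase hPm]
          · refine Or.inl ⟨A, hA, fun i hi => ?_, rfl⟩
            have h1 := hA' i hi
            have h2 : i ≠ P := fun h => hPm (h ▸ hi)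
            have h3 : i.val ≠ p := fun h => h2 (Fin.ext h)
            omega
      rw [hE] at h
      refine h.congr fun i j => ?_
      have hBc : B.card = p.choose d := by
        rw [Finset.card_image_of_injOn, Finset.card_powersetCard, hcI]
        intro A hA A' hA' hAA
        rw [Finset.mem_coe, Finset.mem_powersetCard] at hA hA'
        rw [← Finset.erase_insert (hPA hA.1), ← Finset.erase_insert (hPA hA'.1),
          indExp_injective hAA]
      have hsum : ∑ m ∈ B, (T m).card.choose i = p.choose d * (p - d).choose i := by
        rw [← hBc, ← smul_eq_mul, ← Finset.sum_const]
        refine Finset.sum_congr rfl fun m hm => ?_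
        obtain ⟨A, hA, hAc, rfl⟩ := hB m hm
        rw [hT hA, Finset.card_sdiff_of_subset hA, hAc, hcI]
      rw [hsum]
      -- $\binom{p}{d}\binom{p-d}{i}=\binom{p}{d+i}\binom{d+i}{i}$, so the new contribution is the
      -- missing term of Pascal's rule for $\binom{p+1}{d+1+i}$.
      have h1 := Nat.choose_mul (n := p) (k := d + i) (s := d) (by omega)
      rw [Nat.add_sub_cancel_left] at h1
      rw [← h1, show d + 1 + i = (d + i) + 1 by ring, Nat.choose_succ_succ' p,
        Nat.choose_symm_add]
      split_ifs
      · ring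
      · rfl
    · intro m hm
      obtain ⟨A, hA, hAc, rfl⟩ := hB m hm
      rw [degree_indExp, Finset.card_insert_of_notMem (hPA hA), hAc]
    · rintro m hm _ ⟨A', hAc', hA', rfl⟩ a ha
      obtain ⟨A, hA, hAc, rfl⟩ := hB m hm
      refine key hA (fun i hi => (hA' i hi).le) (fun hAA => ?_) a ha
      have hs : A' ⊆ A := fun i hi => (Finset.mem_insert.1 (hAA hi)).resolve_left fun h => by
        have := hA' i hi
        rw [h] at this
        exact this.false
      have := Finset.card_le_card hs
      omega
    · intro m hm s hs hsm a ha
      obtain ⟨A, hA, hAc, rfl⟩ := hB m hm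
      obtain ⟨A', hA', hAc', rfl⟩ := hB s hs
      refine key hA (fun i hi => ?_) (fun hAA => hsm ?_) a ha
      · rcases Finset.mem_insert.1 hi with rfl | hi
        · exact le_rfl
        · exact (Finset.mem_Iio.1 (hA' hi)).le
      · rw [Finset.eq_of_subset_of_card_le hAA (by
          rw [Finset.card_insert_of_notMem (hPA hA), Finset.card_insert_of_notMem (hPA hA'), hAc,
            hAc'])]
    · intro m hm i hi
      obtain ⟨A, hA, hAc, rfl⟩ := hB m hm
      rw [hT hA, Finset.mem_sdiff, Finset.mem_Iio] at hi
      refine ⟨_, ⟨insert i A, by rw [Finset.card_insert_of_notMem hi.2, hAc], fun j hj => ?_, rfl⟩,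
        fun j => ?_⟩
      · rcases Finset.mem_insert.1 hj with rfl | hj
        · exact hi.1
        · exact Fin.lt_def.1 (Finset.mem_Iio.1 (hA hj))
      · simp only [Finsupp.add_apply, indExp_apply, Finset.mem_insert, Finsupp.single_apply]
        split_ifs <;> simp_all

/-- For $x_A^2$ the colon ideal is generated by the variables outside $A$: $x_i x_A$ divides $x_i
x_A^2$, and every other generator involves a variable outside $A$. The bound $1\le d$ gives $d+1\le
2d$, so degrees do not drop. -/
lemma hasMinimalResolution_squares (d : ℕ) (hd : 1 ≤ d) :
    HasMinimalResolution
      (Ideal.span ((fun s => monomial s (1 : k)) ''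
        (squarefreeExps n (d + 1) n ∪ (squareExps n d : Set (Fin n →₀ ℕ))))) (2 * d)
      fun i j => (if j = (d + 1 : ℕ) then n.choose (d + 1 + i) * (d + i).choose i else 0) +
        if j = (2 * d : ℕ) then n.choose d * (n - d).choose i else 0 := by
  have hB : ∀ m ∈ squareExps n d, ∃ A : Finset (Fin n), A.card = d ∧ m = 2 • indExp A := by
    intro m hm
    obtain ⟨A, hA, rfl⟩ := Finset.mem_image.1 hm
    exact ⟨A, (Finset.mem_powersetCard.1 hA).2, rfl⟩
  let T : (Fin n →₀ ℕ) → Finset (Fin n) := fun m => Finset.univ.filter fun i => m i = 0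
  have hT : ∀ A : Finset (Fin n), T (2 • indExp A) = Aᶜ := fun A => by
    ext i
    simp [T, indExp_apply]
  have key : ∀ {A A' : Finset (Fin n)}, ¬ A' ⊆ A →
      ∀ a, indExp A' ≤ 2 • indExp A + a → ∃ i ∈ T (2 • indExp A), a i ≠ 0 := by
    intro A A' hAA a ha
    obtain ⟨i, hi, hi', hia⟩ := exists_mem_of_indExp_le ha hAA
    exact ⟨i, by rw [hT, Finset.mem_compl]; exact hi', hia⟩
  have h := (hasMinimalResolution_squarefree (k := k) (n := n) d n le_rfl).add_monomials
    (e' := 2 * d) (by omega) (squareExps n d) T ?_ ?_ ?_ ?_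
  · refine h.congr fun i j => ?_
    have hBc : (squareExps n d).card = n.choose d := by
      rw [squareExps, Finset.card_image_of_injective, Finset.card_powersetCard, Finset.card_fin]
      intro A A' hAA
      exact indExp_injective (smul_right_injective _ two_ne_zero hAA)
    have hsum : ∑ m ∈ squareExps n d, (T m).card.choose i = n.choose d * (n - d).choose i := by
      rw [← hBc, ← smul_eq_mul, ← Finset.sum_const]
      refine Finset.sum_congr rfl fun m hm => ?_
      obtain ⟨A, hA, rfl⟩ := hB m hm
      rw [hT, Finset.card_compl, Fintype.card_fin, hA]
    rw [hsum]
  · intro m hm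
    obtain ⟨A, hA, rfl⟩ := hB m hm
    rw [map_nsmul, degree_indExp, hA, smul_eq_mul]
  · rintro m hm _ ⟨A', hA', -, rfl⟩ a ha
    obtain ⟨A, hA, rfl⟩ := hB m hm
    refine key (fun hAA => ?_) a ha
    have := Finset.card_le_card hAA
    omega
  · intro m hm s hs hsm a ha
    obtain ⟨A, hA, rfl⟩ := hB m hm
    obtain ⟨A', hA', rfl⟩ := hB s hs
    refine key (A' := A') (fun hAA => hsm ?_) a (le_trans (fun i => ?_) ha)
    · rw [Finset.eq_of_subset_of_card_le hAA (by omega)]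
    · rw [Finsupp.smul_apply, smul_eq_mul]
      omega
  · intro m hm i hi
    obtain ⟨A, hA, rfl⟩ := hB m hm
    rw [hT, Finset.mem_compl] at hi
    refine ⟨_, ⟨insert i A, by rw [Finset.card_insert_of_notMem hi, hA], fun j _ => j.2, rfl⟩,
      fun j => ?_⟩
    simp only [Finsupp.add_apply, Finsupp.smul_apply, indExp_apply, Finset.mem_insert,
      Finsupp.single_apply]
    split_ifs <;> simp_all

end Resolution

/-! ### Symbolic powers through orders of vanishing. -/

section SymbolicPower

variable {k : Type u} [Field k] {n : ℕ}

/-- The prime ideal generated by the variables in `A`. -/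
def varIdeal (k : Type u) [Field k] {n : ℕ} (A : Finset (Fin n)) : Ideal (MvPolynomial (Fin n) k) :=
  Ideal.span (X '' (A : Set (Fin n)))

/-- The substitution which multiplies the variables in `A` by a new variable. -/
def scaleVars (k : Type u) [Field k] {n : ℕ} (A : Finset (Fin n)) :
    MvPolynomial (Fin n) k →ₐ[k] Polynomial (MvPolynomial (Fin n) k) :=
  aeval fun i => Polynomial.C (X i) * if i ∈ A then Polynomial.X else 1

lemma scaleVars_monomial (A : Finset (Fin n)) (m : Fin n →₀ ℕ) (r : k) :
    scaleVars k A (monomial m r) = Polynomial.C (monomial m r) * Polynomial.X ^ ∑ i ∈ A, m i := by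
  rw [scaleVars, aeval_monomial, Finsupp.prod_fintype _ _ fun _ => pow_zero _]
  simp only [mul_pow, ite_pow, one_pow]
  rw [Finset.prod_mul_distrib, Finset.prod_ite_mem, Finset.univ_inter, Finset.prod_pow_eq_pow_sum,
    ← mul_assoc, monomial_eq, Finsupp.prod_fintype _ _ fun _ => pow_zero _, Polynomial.C_mul,
    map_prod]
  simp only [Polynomial.C_pow]
  rfl

lemma coeff_scaleVars (A : Finset (Fin n)) (p : MvPolynomial (Fin n) k) (m : Fin n →₀ ℕ) (j : ℕ) :
    coeff m ((scaleVars k A p).coeff j) = if ∑ i ∈ A, m i = j then coeff m p else 0 := by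
  induction p using MvPolynomial.induction_on' with
  | add p q hp hq =>
    rw [map_add, Polynomial.coeff_add, coeff_add, hp, hq, coeff_add]
    split_ifs <;> simp
  | monomial m' r =>
    rw [scaleVars_monomial, Polynomial.coeff_C_mul_X_pow, coeff_monomial]
    by_cases h : m' = m
    · subst h
      split_ifs <;> simp_all
    · split_ifs <;> simp [coeff_monomial, h]

lemma X_pow_dvd_scaleVars_iff (A : Finset (Fin n)) (p : MvPolynomial (Fin n) k) (r : ℕ) :
    Polynomial.X ^ r ∣ scaleVars k A p ↔ ∀ m ∈ p.support, r ≤ ∑ i ∈ A, m i := by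
  rw [Polynomial.X_pow_dvd_iff]
  constructor
  · intro h m hm
    by_contra! hr
    have := coeff_scaleVars A p m (∑ i ∈ A, m i)
    rw [h _ hr, if_pos rfl, coeff_zero] at this
    exact mem_support_iff.1 hm this.symm
  · intro h j hj
    ext m
    rw [coeff_scaleVars, coeff_zero, ite_eq_right_iff]
    intro hm
    by_contra h'
    have := h m (mem_support_iff.2 h')
    omega

/-- Membership becomes divisibility by the prime element `Polynomial.X`, which yields primality of
`varIdeal` and lets factors outside it be cancelled from powers. -/
lemma mem_varIdeal_iff (A : Finset (Fin n)) (p : MvPolynomial (Fin n) k) :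
    p ∈ varIdeal k A ↔ Polynomial.X ∣ scaleVars k A p := by
  have := X_pow_dvd_scaleVars_iff A p 1
  rw [pow_one] at this
  rw [this, varIdeal, mem_ideal_span_X_image]
  refine forall₂_congr fun m _ => ?_
  rw [Nat.one_le_iff_ne_zero, Ne, Finset.sum_eq_zero_iff]
  simp

instance varIdeal_isPrime (A : Finset (Fin n)) : (varIdeal k A).IsPrime := by
  constructor
  · intro h
    have h1 : (1 : MvPolynomial (Fin n) k) ∈ varIdeal k A := h ▸ Submodule.mem_top
    rw [mem_varIdeal_iff, map_one] at h1
    exact Polynomial.prime_X.not_dvd_one h1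
  · intro p q hpq
    rw [mem_varIdeal_iff, map_mul] at hpq
    rw [mem_varIdeal_iff, mem_varIdeal_iff]
    exact Polynomial.prime_X.dvd_or_dvd hpq

lemma X_mem_varIdeal_iff {A : Finset (Fin n)} {i : Fin n} :
    (X i : MvPolynomial (Fin n) k) ∈ varIdeal k A ↔ i ∈ A := by
  refine ⟨fun h => ?_, fun h => Ideal.subset_span ⟨i, h, rfl⟩⟩
  rw [varIdeal, mem_ideal_span_X_image] at h
  obtain ⟨j, hj, hij⟩ := h (Finsupp.single i 1) (by simp [X])
  rw [Finsupp.single_apply] at hij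
  split_ifs at hij with h2
  · rwa [h2]
  · exact absurd rfl hij

lemma varIdeal_le_iff {A B : Finset (Fin n)} : varIdeal k A ≤ varIdeal k B ↔ A ⊆ B :=
  ⟨fun h _ hi => X_mem_varIdeal_iff.1 (h (X_mem_varIdeal_iff.2 hi)),
    fun h => Ideal.span_mono (Set.image_mono h)⟩

lemma starIdeal_le_iff {c : ℕ} {P : Ideal (MvPolynomial (Fin n) k)} (hP : P.IsPrime) :
    starIdeal k n c ≤ P ↔ ∃ A : Finset (Fin n), A.card = c ∧ varIdeal k A ≤ P := by
  have h : starIdeal k n c = (Finset.powersetCard c Finset.univ).inf (varIdeal k) := by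
    simp [starIdeal, Finset.inf_eq_iInf, varIdeal]
  rw [h, hP.inf_le']
  simp

/-- A prime containing a finite intersection contains one of its members, and distinct subsets of
equal size give incomparable primes. -/
lemma mem_minimalPrimes_starIdeal_iff {c : ℕ} {P : Ideal (MvPolynomial (Fin n) k)} :
    P ∈ (starIdeal k n c).minimalPrimes ↔
      ∃ A : Finset (Fin n), A.card = c ∧ varIdeal k A = P := by
  constructor
  · rintro ⟨⟨hP, hI⟩, hmin⟩
    obtain ⟨A, hA, hAP⟩ := (starIdeal_le_iff hP).1 hI
    exact ⟨A, hA, le_antisymm hAP (hmin ⟨varIdeal_isPrime A,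
      (starIdeal_le_iff (varIdeal_isPrime A)).2 ⟨A, hA, le_rfl⟩⟩ hAP)⟩
  · rintro ⟨A, hA, rfl⟩
    refine ⟨⟨varIdeal_isPrime A, (starIdeal_le_iff (varIdeal_isPrime A)).2 ⟨A, hA, le_rfl⟩⟩, ?_⟩
    rintro P' ⟨hP', hI⟩ hle
    obtain ⟨B, hB, hBP⟩ := (starIdeal_le_iff hP').1 hI
    rwa [← Finset.eq_of_subset_of_card_le (varIdeal_le_iff.1 (hBP.trans hle))
      (hA.trans hB.symm).le]

/-- The contraction of the powers of `I_{n,c}` from the localization at the ideal of the variables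
in `A`. -/
lemma comap_map_starIdeal_pow {c : ℕ} {A : Finset (Fin n)} (hA : A.card = c) (r : ℕ)
    (p : MvPolynomial (Fin n) k) :
    p ∈ ((starIdeal k n c ^ r).map
      (algebraMap _ (Localization.AtPrime (varIdeal k A)))).comap
      (algebraMap _ (Localization.AtPrime (varIdeal k A))) ↔
      ∀ m ∈ p.support, r ≤ ∑ i ∈ A, m i := by
  rw [Ideal.mem_comap,
    IsLocalization.algebraMap_mem_map_algebraMap_iff (varIdeal k A).primeCompl]
  have hle : ∀ q ∈ varIdeal k A ^ r, Polynomial.X ^ r ∣ scaleVars k A q := by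
    intro q hq
    have h1 : (varIdeal k A).map (scaleVars k A) ≤
        Ideal.span {Polynomial.X} := by
      rw [Ideal.map_le_iff_le_comap]
      intro x hx
      exact Ideal.mem_span_singleton.2 ((mem_varIdeal_iff A x).1 hx)
    have h2 := Ideal.pow_right_mono h1 r (by
      rw [← Ideal.map_pow]
      exact Ideal.mem_map_of_mem _ hq)
    rwa [Ideal.span_singleton_pow, Ideal.mem_span_singleton] at h2
  constructor
  · rintro ⟨t, ht, htp⟩
    have hI : starIdeal k n c ≤ varIdeal k A :=
      (starIdeal_le_iff (varIdeal_isPrime A)).2 ⟨A, hA, le_rfl⟩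
    have h1 := hle _ (Ideal.pow_right_mono hI r htp)
    rw [map_mul] at h1
    rw [← X_pow_dvd_scaleVars_iff]
    exact Polynomial.prime_X.pow_dvd_of_dvd_mul_left r
      (fun h => ht ((mem_varIdeal_iff A t).2 h)) h1
  · intro hp
    -- This product becomes a unit in the localization. For `a ∈ A`, `t * X a` lies in $I_{n,c}$,
    -- since every $c$-set other than `A` meets the complement of `A`.
    let t : MvPolynomial (Fin n) k := ∏ i ∈ Aᶜ, X i
    have ht : ∀ a ∈ A, t * X a ∈ starIdeal k n c := by
      intro a ha
      simp only [starIdeal, Ideal.mem_iInf]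
      intro B hB
      by_cases hBA : B ⊆ A
      · rw [Finset.eq_of_subset_of_card_le hBA (hA.trans hB.symm).le]
        exact Ideal.mul_mem_left _ _ (Ideal.subset_span ⟨a, ha, rfl⟩)
      · obtain ⟨b, hb, hbA⟩ := Finset.not_subset.1 hBA
        refine Ideal.mul_mem_right _ _ (Ideal.mem_of_dvd _
          (Finset.dvd_prod_of_mem _ (Finset.mem_compl.2 hbA)) (Ideal.subset_span ⟨b, hb, rfl⟩))
    refine ⟨t ^ r, ?_, ?_⟩
    · have hX : ∀ i ∈ Aᶜ, (X i : MvPolynomial (Fin n) k) ∈ (varIdeal k A).primeCompl :=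
        fun i hi h => Finset.mem_compl.1 hi (X_mem_varIdeal_iff.1 h)
      exact Submonoid.pow_mem _ (Submonoid.prod_mem _ hX) r
    · have key : ∀ (s : ℕ) (m : Fin n →₀ ℕ) (b : k), s ≤ ∑ i ∈ A, m i →
          t ^ s * monomial m b ∈ starIdeal k n c ^ s := by
        intro s
        induction s with
        | zero => simp
        | succ s ih =>
          intro m b hm
          obtain ⟨a, ha, ham⟩ : ∃ a ∈ A, m a ≠ 0 := by
            by_contra! h
            rw [Finset.sum_eq_zero h] at hm
            omega
          have hle : Finsupp.single a 1 ≤ m :=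
            Finsupp.single_le_iff.2 (Nat.one_le_iff_ne_zero.2 ham)
          obtain ⟨m', rfl⟩ := exists_add_of_le hle
          have hm' : s ≤ ∑ i ∈ A, m' i := by
            simp only [Finsupp.add_apply, Finset.sum_add_distrib, Finsupp.single_apply,
              Finset.sum_ite_eq, ha, if_true] at hm
            omega
          have h1 : t ^ (s + 1) * monomial (Finsupp.single a 1 + m') b =
              (t ^ s * monomial m' b) * (t * X a) := by
            rw [show (monomial (Finsupp.single a 1 + m') b : MvPolynomial (Fin n) k) =
              X a * monomial m' b by rw [X, monomial_mul, one_mul]]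
            ring
          rw [h1, pow_succ (starIdeal k n c)]
          exact Ideal.mul_mem_mul (ih m' b hm') (ht a ha)
      rw [p.as_sum, Finset.mul_sum]
      exact Ideal.sum_mem _ fun m hm => key r m _ (hp m hm)

lemma mem_symbolicPower_starIdeal_iff {c r : ℕ} (p : MvPolynomial (Fin n) k) :
    p ∈ symbolicPower (starIdeal k n c) r ↔
      ∀ m ∈ p.support, ∀ A : Finset (Fin n), A.card = c → r ≤ ∑ i ∈ A, m i := by
  rw [symbolicPower, Ideal.mem_iInf]
  constructor
  · intro h m hm A hA
    exact (comap_map_starIdeal_pow hA r p).1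
      (h ⟨varIdeal k A, mem_minimalPrimes_starIdeal_iff.2 ⟨A, hA, rfl⟩⟩) m hm
  · rintro h ⟨P, hP⟩
    obtain ⟨A, hA, rfl⟩ := mem_minimalPrimes_starIdeal_iff.1 hP
    exact (comap_map_starIdeal_pow hA r p).2 fun m hm => h m hm A hA

lemma symbolicPower_starIdeal_two {c : ℕ} (hc : 2 ≤ c) (hcn : c ≤ n) :
    symbolicPower (starIdeal k n c) 2 = Ideal.span ((fun s => monomial s (1 : k)) ''
      (squarefreeExps n (n - c + 2) n ∪ (squareExps n (n - c + 1) : Set (Fin n →₀ ℕ)))) := by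
  ext p
  rw [mem_symbolicPower_starIdeal_iff, mem_ideal_span_monomial_image]
  exact forall₂_congr fun m _ => (exists_le_iff hc hcn m).symm

end SymbolicPower

end

end StarConfiguration

/-! ### The Betti table. -/

open StarConfiguration in
theorem corollary4p5 {k : Type*} [Field k] (n c : ℕ) (hc : 2 ≤ c) (hcn : c ≤ n) :
    Nonempty (StarConfiguration.GradedFreeResolution
      (StarConfiguration.symbolicPower (StarConfiguration.starIdeal k n c) 2)) ∧
    ∀ (F : StarConfiguration.GradedFreeResolution
      (StarConfiguration.symbolicPower (StarConfiguration.starIdeal k n c) 2))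
      (i : ℕ) (j : ℤ),
      (c < n → F.betti i (i + j) =
        (((if j = (n : ℤ) - c + 2 then
            if i + 2 ≤ c then n.choose (c - 2 - i) * (n - c + 1 + i).choose i else 0
          else if j = 2 * ((n : ℤ) - c + 1) then n.choose (c - 1) * (c - 1).choose i
          else 0 : ℕ)) : Cardinal)) ∧
      (c = n → F.betti i (i + j) =
        (((if j = 2 then
            (if i + 2 ≤ c then n.choose (c - 2 - i) * (n - c + 1 + i).choose i else 0) +
              n.choose (c - 1) * (c - 1).choose i
          else 0 : ℕ)) : Cardinal)) := by
  have h := hasMinimalResolution_squares (k := k) (n := n) (n - c + 1) (by omega)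
  rw [← StarConfiguration.symbolicPower_starIdeal_two hc hcn] at h
  obtain ⟨G, hG, -, hN⟩ := h
  refine ⟨⟨G⟩, fun F i j => ?_⟩
  have hF : F.betti i (i + j) = _ :=
    (GradedFreeResolution.betti_eq F G i (i + j)).trans
      ((GradedFreeResolution.betti_eq_card hG i (i + j)).trans (hN i j))
  -- Symmetry of binomials. The case split is essential: for `i + 2 > c` the truncated `c - 2 - i`
  -- is `0` and would give $\binom{n}{0}=1$ instead of $0$.
  have h1 : n.choose (n - c + 1 + 1 + i) * (n - c + 1 + i).choose i =
      if i + 2 ≤ c then n.choose (c - 2 - i) * (n - c + 1 + i).choose i else 0 := by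
    split_ifs with hi
    · rw [← Nat.choose_symm (show c - 2 - i ≤ n by omega),
        show n - (c - 2 - i) = n - c + 1 + 1 + i by omega]
    · rw [Nat.choose_eq_zero_of_lt (by omega), zero_mul]
  have h2 : n.choose (n - c + 1) * (n - (n - c + 1)).choose i =
      n.choose (c - 1) * (c - 1).choose i := by
    rw [← Nat.choose_symm (show c - 1 ≤ n by omega), show n - (c - 1) = n - c + 1 by omega,
      show n - (n - c + 1) = c - 1 by omega]
  dsimp only at hF
  rw [h1, h2] at hF
  rw [hF]
  have e1 : ((n - c + 1 + 1 : ℕ) : ℤ) = n - c + 2 := by omega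
  have e2 : ((2 * (n - c + 1) : ℕ) : ℤ) = 2 * (n - c + 1) := by omega
  rw [e1, e2]
  -- The degrees $n-c+2$ and $2(n-c+1)$ differ exactly by $n-c$: for $c<n$ at most one summand
  -- survives, for $c=n$ both sit in degree $2$.
  refine ⟨fun hlt => ?_, fun heq => ?_⟩
  · congr 1
    split_ifs <;> omega
  · subst heq
    congr 1
    split_ifs <;> omega
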